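/- Let $d \ge 0$ be an integer, let $0<p<\infty$ and $C>0$ be real numbers, and let $f,g\colon \mathbf{R}^d\to\mathbf{C}$ be two measurable functions such that $|f(x)|\le C(1+|x|)^p$ and $|g(x)|\le C(1+|x|)^{-p-d-1}$ for all $x\in\mathbf{R}^d$, where $|x|$ is the Euclidean norm. In particular $g\in L_1(\mathbf{R}^d)$, so that $\hat g(\xi)=\int g(x)e^{-2\pi i\langle x,\xi\rangle}\,dx$ is defined for every $\xi$, and $f$ defines a tempered distribution $\varphi\mapsto\int f(x)\varphi(x)\,dx$, whose Fourier transform is $\hat f\colon\varphi\mapsto\int f(x)\hat\varphi(x)\,dx$. Assume that $g*f=0$ almost everywhere, where $(g*f)(x)=\int g(y)f(x-y)\,dy$. Then the support of the tempered distribution $\hat f$ is contained in $\{\xi\in\mathbf{R}^d : \hat g(\xi)=0\}$. -/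

import Mathlib

open MeasureTheory SchwartzMap
open scoped FourierTransform Convolution

/-- A product `φ f` of a Schwartz function with a measurable function of at most polynomial growth
is dominated by an integrable power of `1 + ‖x‖`, uniformly over a ball of a Schwartz seminorm. -/
theorem norm_smul_le_of_growth {d : ℕ} {f : EuclideanSpace ℝ (Fin d) → ℂ} {C p : ℝ}
    (hC : 0 ≤ C) (hb : ∀ x, ‖f x‖ ≤ C * (1 + ‖x‖) ^ p)
    (φ : 𝓢(EuclideanSpace ℝ (Fin d), ℂ)) (x : EuclideanSpace ℝ (Fin d)) :
    ‖φ x • f x‖ ≤ (2 ^ (⌈p⌉₊ + d + 1) * C *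
      (Finset.Iic (⌈p⌉₊ + d + 1, 0)).sup (schwartzSeminormFamily ℂ _ ℂ) φ) *
        (1 + ‖x‖) ^ (-((d : ℝ) + 1)) := by
  set m : ℕ := ⌈p⌉₊ + d + 1 with hm
  have hx : 1 ≤ 1 + ‖x‖ := by linarith [norm_nonneg x]
  have hx0 : 0 < 1 + ‖x‖ := by linarith
  set S := (Finset.Iic (m, 0)).sup (schwartzSeminormFamily ℂ _ ℂ) φ with hS
  have h1 : (1 + ‖x‖) ^ m * ‖φ x‖ ≤ 2 ^ m * S := by
    have h := one_add_le_sup_seminorm_apply (𝕜 := ℂ) (m := (m, 0)) (k := m) (n := 0)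
      le_rfl le_rfl φ x
    rw [norm_iteratedFDeriv_zero] at h
    exact h
  have h2 : (1 + ‖x‖) ^ p ≤ (1 + ‖x‖) ^ (m : ℝ) * (1 + ‖x‖) ^ (-((d : ℝ) + 1)) := by
    rw [← Real.rpow_add hx0]
    apply Real.rpow_le_rpow_of_exponent_le hx
    have := Nat.le_ceil p
    rw [hm]
    push_cast
    linarith
  have hr : 0 ≤ (1 + ‖x‖) ^ (-((d : ℝ) + 1)) := by positivity
  rw [norm_smul]
  calc ‖φ x‖ * ‖f x‖
      ≤ ‖φ x‖ * (C * ((1 + ‖x‖) ^ (m : ℝ) * (1 + ‖x‖) ^ (-((d : ℝ) + 1)))) := by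
        gcongr
        exact (hb x).trans (by gcongr)
    _ = ((1 + ‖x‖) ^ m * ‖φ x‖) * (C * (1 + ‖x‖) ^ (-((d : ℝ) + 1))) := by
        rw [Real.rpow_natCast]; ring
    _ ≤ (2 ^ m * S) * (C * (1 + ‖x‖) ^ (-((d : ℝ) + 1))) := by gcongr
    _ = _ := by ring

theorem integrable_one_add_norm_rpow (d : ℕ) :
    Integrable (fun x : EuclideanSpace ℝ (Fin d) => (1 + ‖x‖) ^ (-((d : ℝ) + 1))) :=
  integrable_one_add_norm (by simp)

theorem integrable_smul_of_growth {d : ℕ} {f : EuclideanSpace ℝ (Fin d) → ℂ} {C p : ℝ}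
    (hf : AEMeasurable f volume) (hC : 0 ≤ C) (hb : ∀ x, ‖f x‖ ≤ C * (1 + ‖x‖) ^ p)
    (φ : 𝓢(EuclideanSpace ℝ (Fin d), ℂ)) : Integrable (fun x => φ x • f x) :=
  ((integrable_one_add_norm_rpow d).const_mul _).mono'
    (φ.continuous.aestronglyMeasurable.smul hf.aestronglyMeasurable)
    (Filter.Eventually.of_forall fun x => norm_smul_le_of_growth hC hb φ x)

/-- The tempered distribution `φ ↦ ∫ φ(x) f(x) dx` on `ℝ^d` defined by a measurable function `f`
with `|f(x)| ≤ C (1 + |x|)^p` for all `x`. -/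
noncomputable def temperedOfGrowth {d : ℕ} (f : EuclideanSpace ℝ (Fin d) → ℂ) {C p : ℝ}
    (hf : AEMeasurable f volume) (hC : 0 ≤ C) (hb : ∀ x, ‖f x‖ ≤ C * (1 + ‖x‖) ^ p) :
    𝓢'(EuclideanSpace ℝ (Fin d), ℂ) :=
  ContinuousLinearMap.toPointwiseConvergenceCLM _ _ _ _ <|
    mkCLMtoNormedSpace (𝕜 := ℂ) (σ := RingHom.id ℂ)
      (fun φ : 𝓢(EuclideanSpace ℝ (Fin d), ℂ) => ∫ x, φ x • f x)
      (fun φ ψ => by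
        simp only [add_apply, add_smul]
        exact integral_add (integrable_smul_of_growth hf hC hb φ)
          (integrable_smul_of_growth hf hC hb ψ))
      (fun a φ => by
        simp only [smul_apply, smul_assoc, RingHom.id_apply]
        exact integral_smul a _)
      ⟨Finset.Iic (⌈p⌉₊ + d + 1, 0), 2 ^ (⌈p⌉₊ + d + 1) * C *
          ∫ x : EuclideanSpace ℝ (Fin d), (1 + ‖x‖) ^ (-((d : ℝ) + 1)), by positivity, fun φ => by
        refine (norm_integral_le_of_norm_le ((integrable_one_add_norm_rpow d).const_mul _)
          (Filter.Eventually.of_forall fun x => norm_smul_le_of_growth hC hb φ x)).trans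
            (le_of_eq ?_)
        rw [integral_const_mul]
        ring⟩

theorem temperedOfGrowth_apply {d : ℕ} (f : EuclideanSpace ℝ (Fin d) → ℂ) {C p : ℝ}
    (hf : AEMeasurable f volume) (hC : 0 ≤ C) (hb : ∀ x, ‖f x‖ ≤ C * (1 + ‖x‖) ^ p)
    (φ : 𝓢(EuclideanSpace ℝ (Fin d), ℂ)) :
    temperedOfGrowth f hf hC hb φ = ∫ x, φ x • f x := rfl

/-! If `𝓕 g ξ ≠ 0`, then `𝓕 f` vanishes on a ball around `ξ`. Modulating `f` and `g` reduces this to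
`ξ = 0`, where `∫ g ≠ 0`. For a test function `φ` supported in the ball of radius `t`, put `u =
correlation f (𝓕 φ)`. Then `g * u = 0` inherits from `g * f = 0`, and `u` has frequencies at most
`t`, so it is reproduced by averaging against `S = 𝓕⁻ τ` at scale `1/t`, with `τ = 1` on the unit
ball. Hence `(∫ g) u(x) = ∫ g(y) (u(x) - u(x - y)) dy`, and `u(x) - u(x - y) = ∫ (S(z) - S(z - ty))
u(x - z/t) dz`. In the norm weighted by `(1 + t‖x‖)^p` this gives `|∫ g| ‖u‖ ≤ I(t) ‖u‖`, where
`I(t) → 0` as `t → 0`. A small `t`, chosen from `g` and `S` alone, forces `u = 0`, and `u(0)` is the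
pairing of `𝓕 f` with `φ`. The core is `norm_integral_mul_norm_le_of_reproducing` and
`eq_zero_of_reproducing`. -/

/-! ### Submultiplicativity of polynomial weights -/

section Weights

variable {E : Type*} [NormedAddCommGroup E]

theorem one_add_norm_add_rpow_le {s : ℝ} (hs : 0 ≤ s) (a b : E) :
    (1 + ‖a + b‖) ^ s ≤ (1 + ‖a‖) ^ s * (1 + ‖b‖) ^ s := by
  rw [← Real.mul_rpow (by positivity) (by positivity)]
  apply Real.rpow_le_rpow (by positivity) _ hs
  nlinarith [norm_add_le a b, norm_nonneg a, norm_nonneg b,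
    mul_nonneg (norm_nonneg a) (norm_nonneg b)]

theorem one_add_norm_sub_rpow_le {s : ℝ} (hs : 0 ≤ s) (a b : E) :
    (1 + ‖a - b‖) ^ s ≤ (1 + ‖a‖) ^ s * (1 + ‖b‖) ^ s := by
  simpa [sub_eq_add_neg] using one_add_norm_add_rpow_le hs a (-b)

theorem one_add_norm_sub_rpow_neg_le {s : ℝ} (hs : 0 ≤ s) (a b : E) :
    (1 + ‖a - b‖) ^ (-s) ≤ (1 + ‖a‖) ^ (-s) * (1 + ‖b‖) ^ s := by
  have h := one_add_norm_add_rpow_le hs (a - b) b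
  rw [sub_add_cancel] at h
  have h1 : 0 < (1 + ‖a‖) ^ s := by positivity
  have h2 : 0 < (1 + ‖a - b‖) ^ s := by positivity
  rw [Real.rpow_neg (by positivity), Real.rpow_neg (by positivity), inv_mul_eq_div,
    inv_le_comm₀ h2 (by positivity), inv_div, div_le_iff₀ (by positivity)]
  exact h

theorem one_add_norm_le_inv_mul {t : ℝ} (ht : 0 < t) (ht1 : t ≤ 1) (x : E) :
    1 + ‖x‖ ≤ t⁻¹ * (1 + t * ‖x‖) := by
  have h := (one_le_inv₀ ht).2 ht1
  rw [mul_add, inv_mul_cancel_left₀ ht.ne']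
  linarith

theorem one_add_norm_inv_smul_rpow_le [NormedSpace ℝ E] {s t : ℝ} (hs : 0 ≤ s) (ht : 0 < t)
    (ht1 : t ≤ 1) (x : E) :
    (1 + ‖t⁻¹ • x‖) ^ s ≤ (t⁻¹) ^ s * (1 + ‖x‖) ^ s := by
  rw [← Real.mul_rpow (by positivity) (by positivity)]
  apply Real.rpow_le_rpow (by positivity) _ hs
  have h := (one_le_inv₀ ht).2 ht1
  rw [norm_smul, Real.norm_of_nonneg (by positivity)]
  nlinarith [norm_nonneg x]

/-- Dilating the weight along with the kernel keeps the constant free of `t`; with the undilated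
weight a factor `t^(-s)` would spoil the contraction. -/
theorem one_add_mul_norm_sub_inv_smul_rpow_le [NormedSpace ℝ E] {s t : ℝ} (hs : 0 ≤ s)
    (ht : 0 < t) (x z : E) :
    (1 + t * ‖x - t⁻¹ • z‖) ^ s ≤ (1 + t * ‖x‖) ^ s * (1 + ‖z‖) ^ s := by
  have h := one_add_norm_sub_rpow_le hs (t • x) z
  have e : t • x - z = t • (x - t⁻¹ • z) := by rw [smul_sub, smul_inv_smul₀ ht.ne']
  rw [e, norm_smul, norm_smul, Real.norm_of_nonneg ht.le] at h
  exact h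

end Weights

/-- The weighted `L¹` distance between a function and its translate by `h`. -/
noncomputable def weightedTranslationModulus {E : Type*} [NormedAddCommGroup E]
    [MeasurableSpace E] (μ : Measure E) (p : ℝ) (S : E → ℂ) (h : E) : ℝ :=
  ∫ z, ‖S z - S (z - h)‖ * (1 + ‖z‖) ^ p ∂μ

theorem weightedTranslationModulus_nonneg {E : Type*} [NormedAddCommGroup E]
    [MeasurableSpace E] {μ : Measure E} (p : ℝ) (S : E → ℂ) (h : E) :
    0 ≤ weightedTranslationModulus μ p S h :=
  integral_nonneg fun _ => by positivity

/-! ### Schwartz decay and the weighted translation modulus -/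

section Schwartz

variable {E : Type*} [NormedAddCommGroup E] [NormedSpace ℝ E]

theorem SchwartzMap.exists_norm_le_one_add_norm_rpow_neg (ψ : 𝓢(E, ℂ)) (q : ℝ) :
    ∃ K, 0 ≤ K ∧ ∀ v, ‖ψ v‖ ≤ K * (1 + ‖v‖) ^ (-q) := by
  set m : ℕ := ⌈q⌉₊
  refine ⟨2 ^ m * (Finset.Iic (m, 0)).sup (schwartzSeminormFamily ℂ E ℂ) ψ, by positivity,
    fun v => ?_⟩
  have h := one_add_le_sup_seminorm_apply (𝕜 := ℂ) (m := (m, 0)) (k := m) (n := 0)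
    le_rfl le_rfl ψ v
  rw [norm_iteratedFDeriv_zero] at h
  have hv : 1 ≤ 1 + ‖v‖ := by linarith [norm_nonneg v]
  have h2 : (1 + ‖v‖) ^ q ≤ (1 + ‖v‖) ^ m := by
    rw [← Real.rpow_natCast]
    exact Real.rpow_le_rpow_of_exponent_le hv (Nat.le_ceil q)
  rw [Real.rpow_neg (by positivity), ← div_eq_mul_inv, le_div_iff₀ (by positivity), mul_comm]
  exact (mul_le_mul_of_nonneg_right h2 (norm_nonneg _)).trans h

variable [FiniteDimensional ℝ E] [MeasurableSpace E] [BorelSpace E]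
  {μ : Measure E} [μ.IsAddHaarMeasure]

theorem SchwartzMap.integrable_norm_mul_one_add_norm_rpow (ψ : 𝓢(E, ℂ)) (q : ℝ) :
    Integrable (fun v => ‖ψ v‖ * (1 + ‖v‖) ^ q) μ := by
  obtain ⟨K, hK, h⟩ :=
    ψ.exists_norm_le_one_add_norm_rpow_neg (q + (Module.finrank ℝ E + 1 : ℝ))
  have hi : Integrable (fun v : E => (1 + ‖v‖) ^ (-(Module.finrank ℝ E + 1 : ℝ))) μ :=
    integrable_one_add_norm (by linarith)
  refine (hi.const_mul K).mono' (Measurable.aestronglyMeasurable ?_) (.of_forall fun v => ?_)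
  · have := ψ.continuous.measurable
    fun_prop
  · rw [Real.norm_of_nonneg (by positivity)]
    refine (mul_le_mul_of_nonneg_right (h v) (by positivity)).trans_eq ?_
    rw [mul_assoc, ← Real.rpow_add (by positivity)]
    ring_nf

theorem integrable_translate_mul_weight {p : ℝ} (hp : 0 ≤ p) (S : 𝓢(E, ℂ)) (h : E) :
    Integrable (fun z => ‖S (z - h)‖ * (1 + ‖z‖) ^ p) μ ∧
      ∫ z, ‖S (z - h)‖ * (1 + ‖z‖) ^ p ∂μ ≤
        (∫ z, ‖S z‖ * (1 + ‖z‖) ^ p ∂μ) * (1 + ‖h‖) ^ p := by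
  have h0 := S.integrable_norm_mul_one_add_norm_rpow (μ := μ) p
  have h1 := (h0.comp_sub_right h).mul_const ((1 + ‖h‖) ^ p)
  have hle : ∀ z, ‖S (z - h)‖ * (1 + ‖z‖) ^ p ≤
      ‖S (z - h)‖ * (1 + ‖z - h‖) ^ p * (1 + ‖h‖) ^ p := fun z => by
    rw [mul_assoc]
    gcongr
    simpa using one_add_norm_add_rpow_le hp (z - h) h
  have hi : Integrable (fun z => ‖S (z - h)‖ * (1 + ‖z‖) ^ p) μ := by
    refine h1.mono' (Measurable.aestronglyMeasurable ?_) (.of_forall fun z => ?_)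
    · have := S.continuous.measurable
      fun_prop
    · rw [Real.norm_of_nonneg (by positivity)]
      exact hle z
  refine ⟨hi, (integral_mono hi h1 hle).trans_eq ?_⟩
  rw [integral_mul_const, integral_sub_right_eq_self (fun z => ‖S z‖ * (1 + ‖z‖) ^ p) h]

theorem integrable_weightedTranslation {p : ℝ} (hp : 0 ≤ p) (S : 𝓢(E, ℂ)) (h : E) :
    Integrable (fun z => ‖S z - S (z - h)‖ * (1 + ‖z‖) ^ p) μ := by
  refine ((S.integrable_norm_mul_one_add_norm_rpow (μ := μ) p).add
    (integrable_translate_mul_weight hp S h).1).mono' (Measurable.aestronglyMeasurable ?_)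
    (.of_forall fun z => ?_)
  · have := S.continuous.measurable
    fun_prop
  · rw [Real.norm_of_nonneg (by positivity), Pi.add_apply, ← add_mul]
    gcongr
    exact norm_sub_le _ _

/-- This growth bound supplies the integrable majorant `B ‖g y‖ (1 + ‖y‖)^p` for the limit `t → 0`.
-/
theorem exists_weightedTranslationModulus_le {p : ℝ} (hp : 0 ≤ p) (S : 𝓢(E, ℂ)) :
    ∃ B, ∀ h, weightedTranslationModulus μ p S h ≤ B * (1 + ‖h‖) ^ p := by
  refine ⟨2 * ∫ z, ‖S z‖ * (1 + ‖z‖) ^ p ∂μ, fun h => ?_⟩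
  have h0 := S.integrable_norm_mul_one_add_norm_rpow (μ := μ) p
  obtain ⟨h1, h2⟩ := integrable_translate_mul_weight (μ := μ) hp S h
  have h3 : 1 ≤ (1 + ‖h‖) ^ p := Real.one_le_rpow (by linarith [norm_nonneg h]) hp
  have h4 : 0 ≤ ∫ z, ‖S z‖ * (1 + ‖z‖) ^ p ∂μ := integral_nonneg fun _ => by positivity
  calc weightedTranslationModulus μ p S h
      ≤ ∫ z, (‖S z‖ * (1 + ‖z‖) ^ p + ‖S (z - h)‖ * (1 + ‖z‖) ^ p) ∂μ := by
        refine integral_mono (integrable_weightedTranslation hp S h) (h0.add h1) fun z => ?_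
        simp only [← add_mul]
        gcongr
        exact norm_sub_le _ _
    _ ≤ _ := by
        rw [integral_add h0 h1]
        nlinarith

theorem tendsto_weightedTranslationModulus_zero {p : ℝ} (hp : 0 ≤ p) (S : 𝓢(E, ℂ)) :
    Filter.Tendsto (weightedTranslationModulus μ p S) (nhds 0) (nhds 0) := by
  set n : ℝ := Module.finrank ℝ E + 1
  have hn : 0 ≤ n := by positivity
  obtain ⟨K, hK, hS⟩ := S.exists_norm_le_one_add_norm_rpow_neg (p + n)
  have hi : Integrable (fun v : E => (1 + ‖v‖) ^ (-n)) μ :=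
    integrable_one_add_norm (by simp [n])
  have key : Filter.Tendsto (weightedTranslationModulus μ p S) (nhds 0)
      (nhds (∫ z : E, (0 : ℝ) ∂μ)) := by
    refine tendsto_integral_filter_of_dominated_convergence
      (fun z => 2 * (K * 2 ^ (p + n)) * (1 + ‖z‖) ^ (-n)) ?_ ?_ (hi.const_mul _) ?_
    · exact .of_forall fun h => (integrable_weightedTranslation hp S h).1
    -- Restricting to `‖h‖ ≤ 1` bounds the translation loss `(1 + ‖h‖)^(p + n)` by `2^(p + n)`.
    · filter_upwards [Metric.ball_mem_nhds (0 : E) one_pos] with h hh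
      have hh : ‖h‖ ≤ 1 := by simpa using (mem_ball_zero_iff.1 hh).le
      refine .of_forall fun z => ?_
      rw [Real.norm_of_nonneg (by positivity)]
      have h2 : ∀ k : E, ‖k‖ ≤ 1 → ‖S (z - k)‖ ≤ K * 2 ^ (p + n) * (1 + ‖z‖) ^ (-(p + n)) := by
        intro k hk
        refine (hS _).trans ?_
        rw [mul_assoc, mul_comm (2 ^ (p + n) : ℝ)]
        gcongr
        refine (one_add_norm_sub_rpow_neg_le (by positivity) z k).trans ?_
        gcongr
        linarith
      have h3 := h2 0 (by simp)
      rw [sub_zero] at h3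
      calc ‖S z - S (z - h)‖ * (1 + ‖z‖) ^ p
          ≤ (K * 2 ^ (p + n) * (1 + ‖z‖) ^ (-(p + n)) +
              K * 2 ^ (p + n) * (1 + ‖z‖) ^ (-(p + n))) * (1 + ‖z‖) ^ p := by
            gcongr
            exact (norm_sub_le _ _).trans (add_le_add h3 (h2 h hh))
        _ = 2 * (K * 2 ^ (p + n)) * ((1 + ‖z‖) ^ (-(p + n)) * (1 + ‖z‖) ^ p) := by ring
        _ = _ := by
            rw [← Real.rpow_add (by positivity)]
            ring_nf
    · refine .of_forall fun z => ?_
      have hc : Continuous fun h => ‖S z - S (z - h)‖ * (1 + ‖z‖) ^ p := by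
        have := S.continuous
        fun_prop
      simpa using hc.tendsto 0
  simpa using key

theorem measurable_weightedTranslationModulus (p : ℝ) (S : 𝓢(E, ℂ)) :
    Measurable (weightedTranslationModulus μ p S) := by
  have := S.continuous.measurable
  have hm : Measurable (fun q : E × E => ‖S q.2 - S (q.2 - q.1)‖ * (1 + ‖q.2‖) ^ p) := by
    fun_prop
  exact hm.stronglyMeasurable.integral_prod_right'.measurable

theorem integrable_norm_mul_weightedTranslationModulus {p : ℝ} (hp : 0 ≤ p) (S : 𝓢(E, ℂ))
    {g : E → ℂ} (hg : AEStronglyMeasurable g μ)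
    (hgi : Integrable (fun y => ‖g y‖ * (1 + ‖y‖) ^ p) μ) {t : ℝ} (ht : 0 ≤ t) (ht1 : t ≤ 1) :
    Integrable (fun y => ‖g y‖ * weightedTranslationModulus μ p S (t • y)) μ := by
  obtain ⟨B, hB⟩ := exists_weightedTranslationModulus_le (μ := μ) hp S
  have hB0 : 0 ≤ B := by
    simpa using (weightedTranslationModulus_nonneg (μ := μ) p S 0).trans (hB 0)
  refine (hgi.const_mul B).mono' (hg.norm.mul ?_) (.of_forall fun y => ?_)
  · exact ((measurable_weightedTranslationModulus p S).comp
      (measurable_const_smul t)).aestronglyMeasurable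
  · have h0 := weightedTranslationModulus_nonneg (μ := μ) p S (t • y)
    rw [Real.norm_of_nonneg (by positivity), mul_left_comm]
    refine mul_le_mul_of_nonneg_left ((hB _).trans ?_) (norm_nonneg _)
    gcongr
    rw [norm_smul, Real.norm_of_nonneg ht]
    exact mul_le_of_le_one_left (norm_nonneg _) ht1

theorem exists_integral_norm_mul_weightedTranslationModulus_lt {p : ℝ} (hp : 0 ≤ p)
    (S : 𝓢(E, ℂ)) {g : E → ℂ} (hg : AEStronglyMeasurable g μ)
    (hgi : Integrable (fun y => ‖g y‖ * (1 + ‖y‖) ^ p) μ) {ε : ℝ} (hε : 0 < ε) :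
    ∃ t : ℝ, 0 < t ∧ t ≤ 1 ∧ ∫ y, ‖g y‖ * weightedTranslationModulus μ p S (t • y) ∂μ < ε := by
  obtain ⟨B, hB⟩ := exists_weightedTranslationModulus_le (μ := μ) hp S
  have hB0 : 0 ≤ B := by
    simpa using (weightedTranslationModulus_nonneg (μ := μ) p S 0).trans (hB 0)
  have hmem : Set.Ioc (0 : ℝ) 1 ∈ nhdsWithin (0 : ℝ) (Set.Ioi 0) := Ioc_mem_nhdsGT one_pos
  have key : Filter.Tendsto
      (fun t : ℝ => ∫ y, ‖g y‖ * weightedTranslationModulus μ p S (t • y) ∂μ)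
      (nhdsWithin 0 (Set.Ioi 0)) (nhds (∫ y : E, (0 : ℝ) ∂μ)) := by
    refine tendsto_integral_filter_of_dominated_convergence
      (fun y => B * (‖g y‖ * (1 + ‖y‖) ^ p)) ?_ ?_ (hgi.const_mul B) ?_
    · filter_upwards [hmem] with t ht
      exact (integrable_norm_mul_weightedTranslationModulus hp S hg hgi ht.1.le ht.2).1
    · filter_upwards [hmem] with t ht
      refine .of_forall fun y => ?_
      have h0 := weightedTranslationModulus_nonneg (μ := μ) p S (t • y)
      rw [Real.norm_of_nonneg (by positivity), mul_left_comm]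
      refine mul_le_mul_of_nonneg_left ((hB _).trans ?_) (norm_nonneg _)
      gcongr
      rw [norm_smul, Real.norm_of_nonneg ht.1.le]
      exact mul_le_of_le_one_left (norm_nonneg _) ht.2
    · refine .of_forall fun y => ?_
      have h1 : Filter.Tendsto (fun t : ℝ => t • y) (nhdsWithin 0 (Set.Ioi 0)) (nhds 0) := by
        have : Continuous fun t : ℝ => t • y := by fun_prop
        simpa using (this.tendsto 0).mono_left nhdsWithin_le_nhds
      simpa using ((tendsto_weightedTranslationModulus_zero (μ := μ) hp S).comp h1).const_mul ‖g y‖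
  rw [integral_zero] at key
  obtain ⟨t, ht, ht'⟩ := (Filter.Eventually.and hmem (key.eventually (gt_mem_nhds hε))).exists
  exact ⟨t, ht.1, ht.2, ht'⟩

end Schwartz

theorem exists_schwartzMap_eq_one_on_unitBall (E : Type*) [NormedAddCommGroup E]
    [InnerProductSpace ℝ E] [FiniteDimensional ℝ E] :
    ∃ τ : 𝓢(E, ℂ), ∀ ξ, ‖ξ‖ ≤ 1 → τ ξ = 1 := by
  let b : ContDiffBump (0 : E) := ⟨1, 2, one_pos, one_lt_two⟩
  have hc : HasCompactSupport (Complex.ofRealCLM ∘ b) := b.hasCompactSupport.comp_left rfl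
  refine ⟨hc.toSchwartzMap (Complex.ofRealCLM.contDiff.comp b.contDiff), fun ξ hξ => ?_⟩
  have : b ξ = 1 := b.one_of_mem_closedBall (by simpa using hξ)
  simp [this]

/-! ### Reproducing formula for band-limited functions -/

section Reproducing

variable {E : Type*} [NormedAddCommGroup E] [InnerProductSpace ℝ E] [FiniteDimensional ℝ E]
  [MeasurableSpace E] [BorelSpace E]

/-- By Fubini, integrating in `z` first multiplies `φ ξ` by `τ (t • ξ)`, which is `1` wherever `φ`
is nonzero. -/
theorem SchwartzMap.integral_fourierInv_mul_fourier_add_smul (φ τ : 𝓢(E, ℂ)) (t : ℝ)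
    (h : ∀ ξ, φ ξ ≠ 0 → τ (t • ξ) = 1) (v : E) :
    ∫ z, (𝓕⁻ τ) z * (𝓕 φ) (v + t • z) = (𝓕 φ) v := by
  have hS : Integrable (𝓕⁻ τ : 𝓢(E, ℂ)) := SchwartzMap.integrable _
  have hφ : Integrable φ := SchwartzMap.integrable _
  have hτ : ∀ η, ∫ z, Complex.exp (↑(-2 * Real.pi * inner ℝ z η) * Complex.I) * (𝓕⁻ τ) z = τ η := by
    intro η
    have h1 : (𝓕 (𝓕⁻ τ) : 𝓢(E, ℂ)) η = τ η := by rw [FourierTransform.fourier_fourierInv_eq]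
    rw [fourier_coe, Real.fourier_eq'] at h1
    simpa using h1
  have hF : ∀ w, (𝓕 φ) w =
      ∫ ξ, Complex.exp (↑(-2 * Real.pi * inner ℝ ξ w) * Complex.I) * φ ξ := by
    intro w
    rw [fourier_coe, Real.fourier_eq']
    simp
  calc ∫ z, (𝓕⁻ τ) z * (𝓕 φ) (v + t • z)
      = ∫ z, ∫ ξ, (𝓕⁻ τ) z *
          (Complex.exp (↑(-2 * Real.pi * inner ℝ ξ (v + t • z)) * Complex.I) * φ ξ) := by
        simp_rw [integral_const_mul, ← hF]
    _ = ∫ ξ, ∫ z, (𝓕⁻ τ) z *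
          (Complex.exp (↑(-2 * Real.pi * inner ℝ ξ (v + t • z)) * Complex.I) * φ ξ) := by
        refine integral_integral_swap ((hS.mul_prod hφ).mono ?_ (.of_forall fun q => ?_))
        · refine Continuous.aestronglyMeasurable ?_
          have := (𝓕⁻ τ).continuous
          have := φ.continuous
          simp only [Function.uncurry_def]
          fun_prop
        · simp only [Function.uncurry, norm_mul, Complex.norm_exp_ofReal_mul_I, one_mul, le_refl]
    _ = ∫ ξ, Complex.exp (↑(-2 * Real.pi * inner ℝ ξ v) * Complex.I) * φ ξ * τ (t • ξ) := by
        refine integral_congr_ae (.of_forall fun ξ => ?_)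
        simp only [← hτ, ← integral_const_mul]
        refine integral_congr_ae (.of_forall fun z => ?_)
        simp only [inner_add_right, inner_smul_right, real_inner_comm z ξ, mul_add,
          Complex.ofReal_add, add_mul, Complex.exp_add]
        ring
    _ = (𝓕 φ) v := by
        rw [hF]
        refine integral_congr_ae (.of_forall fun ξ => ?_)
        by_cases hξ : φ ξ = 0
        · simp [hξ]
        · simp [h ξ hξ]

end Reproducing

/-! ### Correlation of `f` with a Schwartz function -/

section Correlation

variable {E : Type*} [NormedAddCommGroup E] [InnerProductSpace ℝ E] [FiniteDimensional ℝ E]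
  [MeasurableSpace E] [BorelSpace E]

/-- The correlation `x ↦ ∫ f(y) ψ(y - x) dy`. -/
noncomputable def correlation (f ψ : E → ℂ) (x : E) : ℂ :=
  ∫ y, f y * ψ (y - x)

theorem correlation_eq_integral_add (f ψ : E → ℂ) (x : E) :
    correlation f ψ x = ∫ y, f (y + x) * ψ y := by
  rw [← integral_sub_right_eq_self (fun y => f (y + x) * ψ y) x]
  simp [correlation]

variable {f g : E → ℂ} {C p : ℝ}

theorem stronglyMeasurable_correlation (hf : AEStronglyMeasurable f) (ψ : 𝓢(E, ℂ)) :
    StronglyMeasurable (correlation f ψ) := by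
  -- Replacing `f` by a measurable representative changes no value of the correlation.
  have h : correlation f ψ = correlation (hf.mk f) ψ := by
    ext x
    refine integral_congr_ae ?_
    filter_upwards [hf.ae_eq_mk] with y hy
    rw [hy]
  rw [h]
  have h1 := hf.stronglyMeasurable_mk.measurable
  have h2 := ψ.continuous.measurable
  have hm : Measurable (fun q : E × E => hf.mk f q.2 * ψ (q.2 - q.1)) := by fun_prop
  exact hm.stronglyMeasurable.integral_prod_right'

theorem exists_norm_correlation_le (hp : 0 ≤ p) (hC : 0 ≤ C)
    (hb : ∀ x, ‖f x‖ ≤ C * (1 + ‖x‖) ^ p) (ψ : 𝓢(E, ℂ)) :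
    ∃ M, 0 ≤ M ∧ ∀ x, ‖correlation f ψ x‖ ≤ M * (1 + ‖x‖) ^ p := by
  refine ⟨C * ∫ y, ‖ψ y‖ * (1 + ‖y‖) ^ p,
    mul_nonneg hC (integral_nonneg fun _ => by positivity), fun x => ?_⟩
  rw [correlation_eq_integral_add]
  have hi := (ψ.integrable_norm_mul_one_add_norm_rpow (μ := volume) p).const_mul
    (C * (1 + ‖x‖) ^ p)
  refine (norm_integral_le_of_norm_le hi (.of_forall fun y => ?_)).trans_eq ?_
  · rw [norm_mul]
    calc ‖f (y + x)‖ * ‖ψ y‖ ≤ C * ((1 + ‖y‖) ^ p * (1 + ‖x‖) ^ p) * ‖ψ y‖ := by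
          gcongr
          exact (hb _).trans (by gcongr; exact one_add_norm_add_rpow_le hp y x)
      _ = _ := by ring
  · rw [integral_const_mul]
    ring

theorem integral_mul_correlation_sub_smul (hp : 0 ≤ p) (hC : 0 ≤ C)
    (hf : AEStronglyMeasurable f) (hb : ∀ x, ‖f x‖ ≤ C * (1 + ‖x‖) ^ p) (S ψ : 𝓢(E, ℂ))
    {t : ℝ} (ht : 0 < t) (ht1 : t ≤ 1)
    (h : ∀ v, ∫ z, S z * ψ (v + t⁻¹ • z) = ψ v) (x : E) :
    ∫ z, S z * correlation f ψ (x - t⁻¹ • z) = correlation f ψ x := by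
  -- `p` offsets the growth of `f`; the remaining `dim E + 1` gives integrability in `y`.
  set q : ℝ := p + (Module.finrank ℝ E + 1 : ℝ) with hq
  have hq0 : 0 ≤ q := by positivity
  obtain ⟨K, hK, hψ⟩ := ψ.exists_norm_le_one_add_norm_rpow_neg q
  have hi1 : Integrable (fun y : E => (1 + ‖y‖) ^ (-(Module.finrank ℝ E + 1 : ℝ))) :=
    integrable_one_add_norm (by linarith)
  have hi2 := S.integrable_norm_mul_one_add_norm_rpow (μ := volume) q
  have hint : Integrable (Function.uncurry fun z y : E => S z * (f y * ψ (y - (x - t⁻¹ • z))))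
      (volume.prod volume) := by
    refine ((hi2.mul_prod hi1).const_mul (C * K * ((1 + ‖x‖) ^ q * (t⁻¹) ^ q))).mono' ?_
      (.of_forall fun ⟨z, y⟩ => ?_)
    · have h1 := S.continuous
      have h2 := ψ.continuous
      have h3 : AEStronglyMeasurable (fun r : E × E => f r.2) (volume.prod volume) := hf.comp_snd
      have h4 : Continuous fun r : E × E => S r.1 := by fun_prop
      have h5 : Continuous fun r : E × E => ψ (r.2 - (x - t⁻¹ • r.1)) := by fun_prop
      exact h4.aestronglyMeasurable.mul (h3.mul h5.aestronglyMeasurable)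
    · simp only [Function.uncurry, norm_mul]
      calc ‖S z‖ * (‖f y‖ * ‖ψ (y - (x - t⁻¹ • z))‖)
          ≤ ‖S z‖ * ((C * (1 + ‖y‖) ^ p) * (K * ((1 + ‖y‖) ^ (-q) *
              ((1 + ‖x‖) ^ q * ((t⁻¹) ^ q * (1 + ‖z‖) ^ q))))) := by
            gcongr
            · exact hb y
            · refine (hψ _).trans ?_
              gcongr
              refine (one_add_norm_sub_rpow_neg_le hq0 _ _).trans ?_
              gcongr
              refine (one_add_norm_sub_rpow_le hq0 _ _).trans ?_
              gcongr
              exact one_add_norm_inv_smul_rpow_le hq0 ht ht1 z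
        _ = C * K * ((1 + ‖x‖) ^ q * (t⁻¹) ^ q) * (‖S z‖ * (1 + ‖z‖) ^ q *
              ((1 + ‖y‖) ^ p * (1 + ‖y‖) ^ (-q))) := by ring
        _ = _ := by
            rw [← Real.rpow_add (by positivity), hq]
            ring_nf
  calc ∫ z, S z * correlation f ψ (x - t⁻¹ • z)
      = ∫ z, ∫ y, S z * (f y * ψ (y - (x - t⁻¹ • z))) := by
        simp_rw [integral_const_mul, correlation]
    _ = ∫ y, ∫ z, S z * (f y * ψ (y - (x - t⁻¹ • z))) := integral_integral_swap hint
    _ = correlation f ψ x := by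
        refine integral_congr_ae (.of_forall fun y => ?_)
        simp only [← h (y - x), ← integral_const_mul]
        refine integral_congr_ae (.of_forall fun z => ?_)
        have : y - (x - t⁻¹ • z) = y - x + t⁻¹ • z := by abel
        simp only [this]
        ring

/-- By Fubini, `g * correlation f ψ` is the correlation of `g * f` with `ψ`. -/
theorem integral_mul_correlation_sub (hp : 0 ≤ p) (hC : 0 ≤ C)
    (hf : AEStronglyMeasurable f) (hb : ∀ x, ‖f x‖ ≤ C * (1 + ‖x‖) ^ p)
    (hg : AEStronglyMeasurable g) (hgi : Integrable (fun y => ‖g y‖ * (1 + ‖y‖) ^ p))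
    (hconv : ∀ᵐ w, ∫ y, g y * f (w - y) = 0) (ψ : 𝓢(E, ℂ)) (x : E) :
    ∫ y, g y * correlation f ψ (x - y) = 0 := by
  have hi := ((integrable_translate_mul_weight (μ := volume) hp ψ x).1.mul_prod hgi).const_mul C
  have hint : Integrable (Function.uncurry fun w y : E => g y * f (w - y) * ψ (w - x))
      (volume.prod volume) := by
    refine hi.mono' ?_ (.of_forall fun ⟨w, y⟩ => ?_)
    · have h1 : AEStronglyMeasurable (fun r : E × E => g r.2 * f (r.1 - r.2))
          (volume.prod volume) := hg.convolution_integrand (ContinuousLinearMap.mul ℂ ℂ) hf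
      have h2 := ψ.continuous
      have h3 : Continuous fun r : E × E => ψ (r.1 - x) := by fun_prop
      exact h1.mul h3.aestronglyMeasurable
    · simp only [Function.uncurry, norm_mul]
      calc ‖g y‖ * ‖f (w - y)‖ * ‖ψ (w - x)‖
          ≤ ‖g y‖ * (C * ((1 + ‖w‖) ^ p * (1 + ‖y‖) ^ p)) * ‖ψ (w - x)‖ := by
            gcongr
            exact (hb _).trans (by gcongr; exact one_add_norm_sub_rpow_le hp w y)
        _ = _ := by ring
  calc ∫ y, g y * correlation f ψ (x - y)
      = ∫ y, ∫ w, g y * f (w - y) * ψ (w - x) := by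
        refine integral_congr_ae (.of_forall fun y => ?_)
        simp only [correlation, ← integral_const_mul]
        rw [← integral_sub_right_eq_self _ y]
        refine integral_congr_ae (.of_forall fun w => ?_)
        have : w - y - (x - y) = w - x := by abel
        simp only [this]
        ring
    _ = ∫ w, ∫ y, g y * f (w - y) * ψ (w - x) := (integral_integral_swap hint).symm
    _ = 0 := by
        refine integral_eq_zero_of_ae ?_
        filter_upwards [hconv] with w hw
        rw [integral_mul_const, hw, zero_mul, Pi.zero_apply]

end Correlation

/-! ### The contraction argument -/

section Contraction

variable {E : Type*} [NormedAddCommGroup E] [NormedSpace ℝ E] [FiniteDimensional ℝ E]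
  [MeasurableSpace E] [BorelSpace E] {μ : Measure E} [μ.IsAddHaarMeasure]

theorem norm_integral_mul_norm_le_of_reproducing {p : ℝ} (hp : 0 ≤ p) {S : 𝓢(E, ℂ)} {g u : E → ℂ}
    (hg : AEStronglyMeasurable g μ) (hgi : Integrable (fun y => ‖g y‖ * (1 + ‖y‖) ^ p) μ)
    (hu : StronglyMeasurable u) {t : ℝ} (ht : 0 < t) (ht1 : t ≤ 1)
    (hS : ∀ x, ∫ z, S z * u (x - t⁻¹ • z) ∂μ = u x)
    (hgu : ∀ x, ∫ y, g y * u (x - y) ∂μ = 0)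
    {M : ℝ} (hM : 0 ≤ M) (hb : ∀ x, ‖u x‖ ≤ M * (1 + t * ‖x‖) ^ p) (x : E) :
    ‖∫ y, g y ∂μ‖ * ‖u x‖ ≤ (∫ y, ‖g y‖ * weightedTranslationModulus μ p S (t • y) ∂μ) *
      (M * (1 + t * ‖x‖) ^ p) := by
  have hum := hu.measurable
  have hub : ∀ x z, ‖u (x - t⁻¹ • z)‖ ≤ M * (1 + t * ‖x‖) ^ p * (1 + ‖z‖) ^ p := fun x z => by
    refine (hb _).trans ?_
    rw [mul_assoc]
    gcongr
    exact one_add_mul_norm_sub_inv_smul_rpow_le hp ht x z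
  have hiS : ∀ x, Integrable (fun z => S z * u (x - t⁻¹ • z)) μ := fun x => by
    refine ((S.integrable_norm_mul_one_add_norm_rpow (μ := μ) p).const_mul
      (M * (1 + t * ‖x‖) ^ p)).mono' (Measurable.aestronglyMeasurable ?_) (.of_forall fun z => ?_)
    · have := S.continuous.measurable
      fun_prop
    · rw [norm_mul]
      refine (mul_le_mul_of_nonneg_left (hub x z) (norm_nonneg _)).trans_eq ?_
      ring
  have hg1 : Integrable g μ := by
    refine hgi.mono' hg (.of_forall fun y => le_mul_of_one_le_right (norm_nonneg _) ?_)
    exact Real.one_le_rpow (by linarith [norm_nonneg y]) hp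
  have hshift : ∀ y z, u (x - y - t⁻¹ • (z - t • y)) = u (x - t⁻¹ • z) := fun y z => by
    rw [smul_sub, inv_smul_smul₀ ht.ne']
    congr 1
    abel
  have hdiff : ∀ y, ‖u x - u (x - y)‖ ≤
      M * (1 + t * ‖x‖) ^ p * weightedTranslationModulus μ p S (t • y) := fun y => by
    -- The substitution `z ↦ z - t • y` moves the translation from `u`, about which only size is
    -- known, to the smooth kernel `S`.
    have h1 : ∫ z, S (z - t • y) * u (x - t⁻¹ • z) ∂μ = u (x - y) := by
      rw [← hS (x - y),
        ← integral_sub_right_eq_self (fun z => S z * u (x - y - t⁻¹ • z)) (t • y)]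
      simp only [hshift]
    have h2 : Integrable (fun z => S (z - t • y) * u (x - t⁻¹ • z)) μ := by
      simpa only [hshift] using (hiS (x - y)).comp_sub_right (t • y)
    rw [← h1, ← hS x, ← integral_sub (hiS x) h2, weightedTranslationModulus, ← integral_const_mul]
    refine norm_integral_le_of_norm_le ((integrable_weightedTranslation hp S _).const_mul _)
      (.of_forall fun z => ?_)
    rw [← sub_mul, norm_mul]
    refine (mul_le_mul_of_nonneg_left (hub x z) (norm_nonneg _)).trans_eq ?_
    ring
  have hgi2 : Integrable (fun y => g y * u (x - y)) μ := by
    refine (hgi.const_mul (M * (1 + t * ‖x‖) ^ p)).mono'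
      (hg.mul (Measurable.aestronglyMeasurable (by fun_prop))) (.of_forall fun y => ?_)
    have h1 := hub x (t • y)
    rw [inv_smul_smul₀ ht.ne', norm_smul, Real.norm_of_nonneg ht.le] at h1
    rw [norm_mul]
    calc ‖g y‖ * ‖u (x - y)‖
        ≤ ‖g y‖ * (M * (1 + t * ‖x‖) ^ p * (1 + ‖y‖) ^ p) := by
          refine mul_le_mul_of_nonneg_left (h1.trans ?_) (norm_nonneg _)
          gcongr
          exact mul_le_of_le_one_left (norm_nonneg _) ht1
      _ = _ := by ring
  have heq : (∫ y, g y ∂μ) * u x = ∫ y, g y * (u x - u (x - y)) ∂μ := by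
    simp_rw [mul_sub]
    rw [integral_sub (hg1.mul_const _) hgi2, hgu, sub_zero, integral_mul_const]
  rw [← norm_mul, heq, ← integral_mul_const]
  refine norm_integral_le_of_norm_le
    ((integrable_norm_mul_weightedTranslationModulus hp S hg hgi ht.le ht1).mul_const _)
    (.of_forall fun y => ?_)
  rw [norm_mul]
  refine (mul_le_mul_of_nonneg_left (hdiff y) (norm_nonneg _)).trans_eq ?_
  ring

/-- Each use of the preceding estimate improves the bound on `u` by the factor `I / c < 1`. Passing
to the dilated weight costs `(t⁻¹)^p`, but only once. -/
theorem eq_zero_of_reproducing {p : ℝ} (hp : 0 ≤ p) {S : 𝓢(E, ℂ)} {g u : E → ℂ}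
    (hg : AEStronglyMeasurable g μ) (hgi : Integrable (fun y => ‖g y‖ * (1 + ‖y‖) ^ p) μ)
    (hu : StronglyMeasurable u) {t : ℝ} (ht : 0 < t) (ht1 : t ≤ 1)
    (hS : ∀ x, ∫ z, S z * u (x - t⁻¹ • z) ∂μ = u x)
    (hgu : ∀ x, ∫ y, g y * u (x - y) ∂μ = 0)
    (hlt : ∫ y, ‖g y‖ * weightedTranslationModulus μ p S (t • y) ∂μ < ‖∫ y, g y ∂μ‖)
    {M : ℝ} (hM : 0 ≤ M) (hb : ∀ x, ‖u x‖ ≤ M * (1 + ‖x‖) ^ p) (x : E) : u x = 0 := by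
  set I := ∫ y, ‖g y‖ * weightedTranslationModulus μ p S (t • y) ∂μ
  set c := ‖∫ y, g y ∂μ‖
  have hI : 0 ≤ I := integral_nonneg fun y =>
    mul_nonneg (norm_nonneg _) (weightedTranslationModulus_nonneg p S _)
  have hc : 0 < c := hI.trans_lt hlt
  have hθ : 0 ≤ I / c := by positivity
  have hθ1 : I / c < 1 := (div_lt_one hc).2 hlt
  have hiter : ∀ n : ℕ, ∀ x,
      ‖u x‖ ≤ (I / c) ^ n * (M * (t⁻¹) ^ p) * (1 + t * ‖x‖) ^ p := by
    intro n
    induction n with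
    | zero =>
      intro x
      rw [pow_zero, one_mul, mul_assoc]
      refine (hb x).trans ?_
      rw [← Real.mul_rpow (by positivity) (by positivity)]
      gcongr
      exact one_add_norm_le_inv_mul ht ht1 x
    | succ n ih =>
      intro x
      have h := norm_integral_mul_norm_le_of_reproducing hp hg hgi hu ht ht1 hS hgu
        (by positivity) ih x
      rw [← le_div_iff₀' hc] at h
      refine h.trans_eq ?_
      ring
  have hlim : Filter.Tendsto
      (fun n : ℕ => (I / c) ^ n * (M * (t⁻¹) ^ p) * (1 + t * ‖x‖) ^ p) Filter.atTop (nhds 0) := by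
    simpa using ((tendsto_pow_atTop_nhds_zero_of_lt_one hθ hθ1).mul_const
      (M * (t⁻¹) ^ p)).mul_const ((1 + t * ‖x‖) ^ p)
  exact norm_le_zero_iff.1 (ge_of_tendsto' hlim fun n => hiter n x)

end Contraction

/-! ### Characters and frequency shifts -/

section Modulation

variable {E : Type*} [NormedAddCommGroup E] [InnerProductSpace ℝ E] [FiniteDimensional ℝ E]
  [MeasurableSpace E] [BorelSpace E]

/-- The conjugate character `x ↦ exp(-2πi⟨x, ξ⟩)`. -/
noncomputable def conjCharacter (ξ x : E) : ℂ :=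
  Complex.exp (↑(-2 * Real.pi * inner ℝ x ξ) * Complex.I)

omit [FiniteDimensional ℝ E] [MeasurableSpace E] [BorelSpace E] in
theorem norm_conjCharacter (ξ x : E) : ‖conjCharacter ξ x‖ = 1 :=
  Complex.norm_exp_ofReal_mul_I _

omit [FiniteDimensional ℝ E] [MeasurableSpace E] [BorelSpace E] in
theorem continuous_conjCharacter (ξ : E) : Continuous (conjCharacter ξ) := by
  unfold conjCharacter
  fun_prop

omit [FiniteDimensional ℝ E] [MeasurableSpace E] [BorelSpace E] in
theorem conjCharacter_mul_conjCharacter_sub (ξ w y : E) :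
    conjCharacter ξ y * conjCharacter ξ (w - y) = conjCharacter ξ w := by
  simp only [conjCharacter, ← Complex.exp_add, inner_sub_left]
  push_cast
  ring_nf

theorem integral_conjCharacter_mul (g : E → ℂ) (ξ : E) :
    ∫ y, conjCharacter ξ y * g y = 𝓕 g ξ := by
  simp [Real.fourier_eq', conjCharacter]

theorem SchwartzMap.fourier_apply_eq_conjCharacter_mul (φ : 𝓢(E, ℂ)) (ξ x : E) :
    (𝓕 φ) x = conjCharacter ξ x * (𝓕 (compSubConstCLM ℂ (-ξ) φ)) x := by
  simp only [fourier_coe, ← integral_conjCharacter_mul, ← integral_const_mul]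
  rw [← integral_add_right_eq_self _ ξ]
  refine integral_congr_ae (.of_forall fun η => ?_)
  simp only [compSubConstCLM_apply, sub_neg_eq_add, ← mul_assoc]
  congr 1
  simp only [conjCharacter, ← Complex.exp_add, inner_add_left, real_inner_comm ξ x]
  push_cast
  ring_nf

end Modulation

/-! ### Vanishing near a frequency where `𝓕 g` is nonzero -/

section Support

variable {E : Type*} [NormedAddCommGroup E] [InnerProductSpace ℝ E] [FiniteDimensional ℝ E]
  [MeasurableSpace E] [BorelSpace E]

theorem exists_integral_mul_fourier_eq_zero {f g : E → ℂ} {C p : ℝ} (hp : 0 ≤ p) (hC : 0 ≤ C)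
    (hf : AEStronglyMeasurable f) (hb : ∀ x, ‖f x‖ ≤ C * (1 + ‖x‖) ^ p)
    (hg : AEStronglyMeasurable g) (hgi : Integrable (fun y => ‖g y‖ * (1 + ‖y‖) ^ p))
    (hconv : ∀ᵐ w, ∫ y, g y * f (w - y) = 0) (hg0 : ∫ y, g y ≠ 0) :
    ∃ t > 0, ∀ φ : 𝓢(E, ℂ), (∀ ξ, φ ξ ≠ 0 → ‖ξ‖ ≤ t) → ∫ y, f y * (𝓕 φ) y = 0 := by
  obtain ⟨τ, hτ⟩ := exists_schwartzMap_eq_one_on_unitBall E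
  -- `t` is fixed before `φ`, so one ball serves all test functions.
  obtain ⟨t, ht, ht1, hlt⟩ := exists_integral_norm_mul_weightedTranslationModulus_lt hp (𝓕⁻ τ)
    hg hgi (norm_pos_iff.2 hg0)
  refine ⟨t, ht, fun φ hφ => ?_⟩
  have hrep := integral_fourierInv_mul_fourier_add_smul φ τ t⁻¹ fun ξ hξ => hτ _ <| by
    rw [norm_smul, Real.norm_of_nonneg (by positivity), inv_mul_le_iff₀ ht, mul_one]
    exact hφ ξ hξ
  obtain ⟨M, hM, hu⟩ := exists_norm_correlation_le hp hC hb (𝓕 φ)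
  have h := eq_zero_of_reproducing hp hg hgi (stronglyMeasurable_correlation hf (𝓕 φ)) ht ht1
    (integral_mul_correlation_sub_smul hp hC hf hb _ _ ht ht1 hrep)
    (integral_mul_correlation_sub hp hC hf hb hg hgi hconv (𝓕 φ)) hlt hM hu 0
  simpa [correlation] using h

theorem exists_integral_mul_fourier_eq_zero_of_fourier_ne_zero {f g : E → ℂ} {C p : ℝ}
    (hp : 0 ≤ p) (hC : 0 ≤ C)
    (hf : AEStronglyMeasurable f) (hb : ∀ x, ‖f x‖ ≤ C * (1 + ‖x‖) ^ p)
    (hg : AEStronglyMeasurable g) (hgi : Integrable (fun y => ‖g y‖ * (1 + ‖y‖) ^ p))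
    (hconv : ∀ᵐ w, ∫ y, g y * f (w - y) = 0) {ξ : E} (hξ : 𝓕 g ξ ≠ 0) :
    ∃ t > 0, ∀ φ : 𝓢(E, ℂ), (∀ η, φ η ≠ 0 → ‖η - ξ‖ ≤ t) → ∫ y, f y * (𝓕 φ) y = 0 := by
  have he := (continuous_conjCharacter ξ).aestronglyMeasurable (μ := (volume : Measure E))
  obtain ⟨t, ht, h⟩ := exists_integral_mul_fourier_eq_zero
    (f := fun x => conjCharacter ξ x * f x) (g := fun x => conjCharacter ξ x * g x) hp hC
    (he.mul hf) (by simpa [norm_conjCharacter] using hb) (he.mul hg)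
    (by simpa [norm_conjCharacter] using hgi)
    (by
      filter_upwards [hconv] with w hw
      have e : ∀ y, conjCharacter ξ y * g y * (conjCharacter ξ (w - y) * f (w - y)) =
          conjCharacter ξ w * (g y * f (w - y)) := fun y => by
        rw [← conjCharacter_mul_conjCharacter_sub ξ w y]
        ring
      simp only [e, integral_const_mul, hw, mul_zero])
    (by rwa [integral_conjCharacter_mul])
  refine ⟨t, ht, fun φ hφ => ?_⟩
  -- The shifted function `η ↦ φ (η + ξ)` lives near `0`; its Fourier transform differs from that of
  -- `φ` by the character put into `f`.
  rw [← h (compSubConstCLM ℂ (-ξ) φ) fun η hη => by simpa using hφ (η + ξ) (by simpa using hη)]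
  refine integral_congr_ae (.of_forall fun y => ?_)
  simp only [fourier_apply_eq_conjCharacter_mul φ ξ y]
  ring

end Support

theorem propositionA4 (d : ℕ) (p : ℝ) (hp : 0 < p) (C : ℝ) (hC : 0 < C)
    (f g : EuclideanSpace ℝ (Fin d) → ℂ)
    (hf : AEMeasurable f volume) (hg : AEMeasurable g volume)
    (hfb : ∀ x, ‖f x‖ ≤ C * (1 + ‖x‖) ^ p)
    (hgb : ∀ x, ‖g x‖ ≤ C * (1 + ‖x‖) ^ (-p - d - 1))
    (hconv : g ⋆[ContinuousLinearMap.mul ℂ ℂ, volume] f =ᵐ[volume] 0) :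
    Distribution.dsupport
        (𝓕 (temperedOfGrowth f hf hC.le hfb) : 𝓢'(EuclideanSpace ℝ (Fin d), ℂ)) ⊆ {ξ | 𝓕 g ξ = 0} := by
  intro ξ hmem
  by_contra hξ
  -- The decay exponent `-p - d - 1` leaves exactly `-(d + 1)` after multiplying by the weight.
  have hgi : Integrable (fun y => ‖g y‖ * (1 + ‖y‖) ^ p) := by
    refine ((integrable_one_add_norm_rpow d).const_mul C).mono'
      (hg.aestronglyMeasurable.norm.mul (Measurable.aestronglyMeasurable (by fun_prop)))
      (.of_forall fun y => ?_)
    rw [Real.norm_of_nonneg (by positivity)]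
    refine (mul_le_mul_of_nonneg_right (hgb y) (by positivity)).trans_eq ?_
    rw [mul_assoc, ← Real.rpow_add (by positivity)]
    ring_nf
  obtain ⟨t, ht, h⟩ := exists_integral_mul_fourier_eq_zero_of_fourier_ne_zero hp.le hC.le
    hf.aestronglyMeasurable hfb hg.aestronglyMeasurable hgi hconv hξ
  refine (Distribution.notMem_dsupport_iff ξ).2
    ⟨Metric.ball ξ t, fun φ hφ => ?_, Metric.isOpen_ball, Metric.mem_ball_self ht⟩ hmem
  rw [TemperedDistribution.fourier_apply, temperedOfGrowth_apply]
  simp only [smul_eq_mul, mul_comm _ (f _)]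
  exact h φ fun η hη => by simpa [dist_eq_norm] using (hφ (subset_tsupport φ hη)).le
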